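/- Let $k$ be a field, let $k[\varepsilon]$ be the ring of dual numbers ($\varepsilon^2=0$), and let $\mathbf S$ be the category of sequences of $k$-vector spaces: an object $V$ consists of $k$-vector spaces $V^i$ and arbitrary $k$-linear maps $\delta^i\colon V^i\to V^{i+1}$ ($i\in\mathbb Z$), and a morphism $V\to W$ is a family of $k$-linear maps $V^i\to W^i$ commuting with the maps $\delta^i$. For $a\in\mathbb Z\cup\{-\infty\}$ and $b\in\mathbb Z\cup\{\infty\}$ with $a\le b$, let $S_{a,b}\in\mathbf S$ be the sequence with $S_{a,b}^i=k$ if $a\le i\le b$ and $S_{a,b}^i=0$ otherwise, and $\delta^i=(-1)^i\mathrm{id}_k$ for $a\le i<b$. Let $\mathbf S^d$ be the class of objects of $\mathbf S$ that are coproducts in $\mathbf S$ of objects $S_{a,b}$. A non-zero object is indecomposable if it is not a coproduct of two non-zero objects, and an object is completely decomposable if it is a coproduct of indecomposable objects. To $V\in\mathbf S$ one associates the complex $M(V)$ of free $k[\varepsilon]$-modules with $M(V)^i=k[\varepsilon]\otimes_k V^i$ and differential $\varepsilon\delta^i$ (that is, $\varepsilon$ times the $k[\varepsilon]$-linear extension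 of $\delta^i$). Let $D=D(\mathrm{Mod}\,k[\varepsilon])$, and let $D^+$, $D^-$, $D^b\subseteq D$ be the full subcategories of objects with bounded below, bounded above, bounded cohomology, respectively. Let $D^{sb}\subseteq D$ be the full subcategory of objects isomorphic in $D$ to a bounded complex of (arbitrary) projective $k[\varepsilon]$-modules, and for $?=b,-$ let $D^?_{fg}\subseteq D^?$ be the full subcategory of objects all of whose cohomology modules are finitely generated over $k[\varepsilon]$. For $?=sb,b,+$ let $\mathbf S_p^?$ be the full subcategory of $\mathbf S$ whose objects are the $V$ such that $M(V)$ is h-projective (every morphism of complexes from $M(V)$ to an acyclic complex of $k[\varepsilon]$-modules is null-homotopic) and $M(V)$, as an object of $D$, lies in $D^?$. Define $\mathbf S_{p,fg}^?$ for $?=b,-$ in the same way from $D^?_{fg}$. Then $\mathbf S_p^?\cap\mathbf S^d=\mathbf S_p^?$ for $?=sb,b,+$ and $\mathbf S_{p,fg}^?\cap\mathbf S^d=\mathbf S_{p,fg}^?$ for $?=b,-$: every object of these subcategories is a coproduct (direct sum) in $\mathbf S$ of objects $S_{a,b}$ with $a\le b$. In particular, all objects of these subcategories are completely decomposable in $\mathbf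 S$. -/

import Mathlib

open CategoryTheory CategoryTheory.Limits

universe w v u

/-! ### Sequences -/

/-- A sequence in a category `A`: objects `X i` and morphisms `δ i : X i ⟶ X (i + 1)` for `i : ℤ`,
with no condition on the composites `δ i ≫ δ (i + 1)`. -/
structure SeqObj (A : Type u) [Category.{v} A] where
  X : ℤ → A
  δ : ∀ i : ℤ, X i ⟶ X (i + 1)

namespace SeqObj

variable {A : Type u} [Category.{v} A]

/-- A morphism of sequences: a family of morphisms commuting with the structure maps. -/
@[ext]
structure Hom (V W : SeqObj A) where
  f : ∀ i : ℤ, V.X i ⟶ W.X i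
  comm : ∀ i : ℤ, f i ≫ W.δ i = V.δ i ≫ f (i + 1)

/-- The category of sequences in `A`. -/
instance : Category (SeqObj A) where
  Hom V W := Hom V W
  id V := { f := fun i => 𝟙 (V.X i), comm := fun i => by simp }
  comp p q :=
    { f := fun i => p.f i ≫ q.f i
      comm := fun i => by
        rw [Category.assoc, q.comm, ← Category.assoc, p.comm, Category.assoc] }
  id_comp p := by apply Hom.ext; funext i; exact Category.id_comp _
  comp_id p := by apply Hom.ext; funext i; exact Category.comp_id _
  assoc p q r := by apply Hom.ext; funext i; exact Category.assoc _ _ _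

end SeqObj

/-- The category of modules over a commutative ring. -/
abbrev CommModuleCat (R : Type u) [CommRing R] : Type (u + 1) := ModuleCat.{u} R

/-- The category `S = S(Mod k)` of sequences of `k`-vector spaces. -/
abbrev SeqVect (k : Type u) [Field k] : Type (u + 1) := SeqObj (CommModuleCat k)

/-! ### Interval objects, indecomposable and completely decomposable objects -/

/-- The integer `i` satisfies `a ≤ i ≤ b`, where `a ∈ ℤ ∪ {-∞}` and `b ∈ ℤ ∪ {∞}`. -/
def InInterval (a : WithBot ℤ) (b : WithTop ℤ) (i : ℤ) : Prop :=
  a ≤ (i : WithBot ℤ) ∧ (i : WithTop ℤ) ≤ b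

/-- `a ≤ b` for `a ∈ ℤ ∪ {-∞}` and `b ∈ ℤ ∪ {∞}`, compared in `ℤ ∪ {-∞, ∞}`. -/
def EndpointLE (a : WithBot ℤ) (b : WithTop ℤ) : Prop :=
  WithBot.map (fun i : ℤ => (i : WithTop ℤ)) a ≤ (b : WithBot (WithTop ℤ))

open scoped Classical in
/-- The sequence `S_{a,b}`, equal to `k` in the degrees `i` with `a ≤ i ≤ b` and to `0` elsewhere,
with structure map `(-1)^i • id` from degree `i` to degree `i + 1` if both lie in the interval. -/
noncomputable def intervalSeq (k : Type u) [Field k] (a : WithBot ℤ) (b : WithTop ℤ) :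
    SeqVect k where
  X i := if InInterval a b i then ModuleCat.of k k else ModuleCat.of k PUnit.{u + 1}
  δ i :=
    if h : InInterval a b i ∧ InInterval a b (i + 1) then
      eqToHom (if_pos h.1) ≫ (i.negOnePow • 𝟙 (ModuleCat.of k k)) ≫ eqToHom (if_pos h.2).symm
    else 0

/-- The objects of `S` that are coproducts (in `S`) of objects `S_{a,b}` with `a ≤ b`. -/
def intervalDecomposable (k : Type u) [Field k] : ObjectProperty (SeqVect k) := fun V =>
  ∃ (J : Type u) (a : J → WithBot ℤ) (b : J → WithTop ℤ)
    (inc : ∀ j : J, intervalSeq k (a j) (b j) ⟶ V),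
    (∀ j : J, EndpointLE (a j) (b j)) ∧ Nonempty (IsColimit (Cofan.mk V inc))

/-- A non-zero object is indecomposable if it is not a coproduct of two non-zero objects. -/
def IsIndecomposableObj {C : Type u} [Category.{v} C] (V : C) : Prop :=
  ¬ IsZero V ∧ ∀ (Y Z : C) (p : Y ⟶ V) (q : Z ⟶ V),
    Nonempty (IsColimit (BinaryCofan.mk p q)) → IsZero Y ∨ IsZero Z

/-- The objects that are (small) coproducts of indecomposable objects. -/
def completelyDecomposable (C : Type u) [Category.{v} C] : ObjectProperty C := fun V =>
  ∃ (J : Type v) (X : J → C) (inc : ∀ j : J, X j ⟶ V),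
    (∀ j : J, IsIndecomposableObj (X j)) ∧ Nonempty (IsColimit (Cofan.mk V inc))

/-! ### From sequences to minimal complexes of free modules over the dual numbers -/

/-- The category of modules over the dual numbers `k[ε]`, where `ε ^ 2 = 0`. -/
abbrev ModDual (k : Type u) [Field k] : Type (u + 1) := CommModuleCat (DualNumber k)

/-- The minimal complex of free `k[ε]`-modules corresponding to the sequence `V`: in degree `i` it is
`k[ε] ⊗ V i`, and its differential is `ε` times the `k[ε]`-linear extension of `δ i`. -/
noncomputable def minimalComplex {k : Type u} [Field k] (V : SeqVect k) :
    CochainComplex (ModDual k) ℤ :=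
  CochainComplex.of
    (fun i => (ModuleCat.extendScalars (algebraMap k (DualNumber k))).obj (V.X i))
    (fun i => (DualNumber.eps : DualNumber k) •
      (ModuleCat.extendScalars (algebraMap k (DualNumber k))).map (V.δ i))
    (fun i => by
      rw [Linear.smul_comp, Linear.comp_smul, smul_smul, DualNumber.eps_mul_eps, zero_smul])

/-! ### Full subcategories of the derived category of `k[ε]`-modules -/

section Derived

variable (k : Type u) [Field k] [HasDerivedCategory.{w} (ModDual k)]

/-- `D^+`: cohomology vanishing in all sufficiently small degrees. -/
noncomputable def derivedPlus : ObjectProperty (DerivedCategory (ModDual k)) :=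
  (DerivedCategory.TStructure.t (C := ModDual k)).plus

/-- `D^-`: cohomology vanishing in all sufficiently large degrees. -/
noncomputable def derivedMinus : ObjectProperty (DerivedCategory (ModDual k)) :=
  (DerivedCategory.TStructure.t (C := ModDual k)).minus

/-- `D^b`: bounded cohomology. -/
noncomputable def derivedBounded : ObjectProperty (DerivedCategory (ModDual k)) :=
  (DerivedCategory.TStructure.t (C := ModDual k)).bounded

/-- `D^sb`: the objects isomorphic in the derived category to a bounded complex of projective
modules (not necessarily finitely generated). -/
def derivedStrictlyBounded : ObjectProperty (DerivedCategory (ModDual k)) := fun X =>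
  ∃ P : CochainComplex (ModDual k) ℤ, (∀ i : ℤ, Projective (P.X i)) ∧
    (∃ m n : ℤ, ∀ i : ℤ, i < m ∨ n < i → IsZero (P.X i)) ∧
    Nonempty (X ≅ DerivedCategory.Q.obj P)

/-- The objects all of whose cohomology modules are finitely generated over `k[ε]`. -/
def derivedFG : ObjectProperty (DerivedCategory (ModDual k)) := fun X =>
  ∀ i : ℤ, Module.Finite (DualNumber k) ((DerivedCategory.homologyFunctor (ModDual k) i).obj X)

variable {k}

/-- For a property `P` of objects of `D(Mod k[ε])`, the objects `V` of `S` whose minimal complex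
is h-projective and, regarded as an object of `D(Mod k[ε])`, satisfies `P`. If `P` is closed under
isomorphisms, this is the strictly full subcategory corresponding to `P` under the equivalence
between the h-projective minimal complexes up to homotopy and `D(Mod k[ε])`. -/
def seqP (P : ObjectProperty (DerivedCategory (ModDual k))) : ObjectProperty (SeqVect k) :=
  fun V => (minimalComplex V).IsKProjective ∧ P (DerivedCategory.Q.obj (minimalComplex V))

end Derived

/-!
The cohomology of the minimal complex of a sequence `V` in degree `i` is
`ker (δ i) ⊕ V i / im (δ (i - 1))`, so conditions on the cohomology translate into conditions on the
structure maps of `V`. The proof extracts two properties of `V` and shows that they suffice.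

* *Local nilpotence* comes from h-projectivity (`locallyNilpotent_of_isKProjective`). Let `U` be the
  colimit of `V`. The minimal complex of the constant sequence on `U` is acyclic, so the morphism
  induced by `V ⟶ U` is null-homotopic. Since all differentials are divisible by `ε`, so is a
  null-homotopic morphism, which forces `V ⟶ U` to vanish. Hence `U = 0`, that is, every element of
  `V` is killed by some composite of structure maps.

* The *chain condition on images* `ImagesStabilize` says that inside `ker (δ j)` the images of the
  `V a` become constant as `a` tends to `-∞`. It holds if the cohomology is bounded below, because
  then `δ i` is surjective for small `i`, and if the cohomology is finitely generated, because then
  all the kernels are finite-dimensional.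

Given both, choose in each `ker (δ i)` a basis adapted to the filtration by images, and lift each
basis element backwards to a chain starting in the earliest possible degree; the chain condition
makes infinite lifts exist where they are needed. The members of these chains form a basis in every
degree (`ImagesStabilize.exists_chain_basis`): they are independent because a relation can be pushed
forward to the last degree in which one of its chains ends, and they span because, by local
nilpotence, an element can be reduced to zero by subtracting chains one kernel at a time. Up to
signs, a chain is a morphism from an object `S_{a,b}`, so `V` is a coproduct of such objects.

Finally `S_{a,b}` is indecomposable since its endomorphisms are the scalars and a field has no
idempotents other than `0` and `1`.
-/

/-! ### Transition maps and the filtration by images -/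

section LinearAlgebra

variable {k : Type u} [Field k]

section Transition

variable {V : ℤ → Type u} [∀ i, AddCommGroup (V i)] [∀ i, Module k (V i)]
  (δ : ∀ i, V i →ₗ[k] V (i + 1))

/-- The composite of `m` consecutive structure maps, with a target index `j` that is only
propositionally equal to `i + m`. -/
def transitionAux : (m : ℕ) → (i j : ℤ) → i + m = j → (V i →ₗ[k] V j)
  | 0, i, j, h => (show i = j by simpa using h) ▸ LinearMap.id
  | m + 1, i, j, h => transitionAux m (i + 1) j (by push_cast at h; omega) ∘ₗ δ i

/-- The composite `V i → V j` of structure maps of a sequence, for `i ≤ j`. -/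
def transition {i j : ℤ} (h : i ≤ j) : V i →ₗ[k] V j :=
  transitionAux δ (j - i).toNat i j (by omega)

theorem transition_eq_aux {i j : ℤ} (m : ℕ) (h : i + m = j) :
    transition δ (show i ≤ j by omega) = transitionAux δ m i j h := by
  obtain rfl : m = (j - i).toNat := by omega
  rfl

theorem transition_self (i : ℤ) (x : V i) : transition δ (le_refl i) x = x := by
  rw [transition_eq_aux δ 0 (by simp)]
  rfl

theorem transition_of_add_one_le {i j : ℤ} (h : i + 1 ≤ j) (x : V i) :
    transition δ (show i ≤ j by omega) x = transition δ h (δ i x) := by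
  rw [transition_eq_aux δ ((j - (i + 1)).toNat + 1) (by push_cast; omega),
    transition_eq_aux δ (j - (i + 1)).toNat (by omega)]
  rfl

theorem transition_add_one (i : ℤ) (x : V i) :
    transition δ (show i ≤ i + 1 by omega) x = δ i x := by
  rw [transition_of_add_one_le δ le_rfl, transition_self]

theorem transition_transition {i j l : ℤ} (h : i ≤ j) (h' : j ≤ l) (x : V i) :
    transition δ h' (transition δ h x) = transition δ (h.trans h') x := by
  obtain ⟨m, rfl⟩ : ∃ m : ℕ, j = i + m := ⟨(j - i).toNat, by omega⟩
  induction m generalizing i with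
  | zero =>
    obtain ⟨j, hj⟩ : ∃ j, j = i + (0 : ℕ) := ⟨_, rfl⟩
    have : ∀ (j : ℤ) (_ : j = i) (h : i ≤ j) (h' : j ≤ l),
        transition δ h' (transition δ h x) = transition δ (h.trans h') x := by
      rintro j rfl h h'
      rw [transition_self]
    exact this _ (by simp) h h'
  | succ m ih =>
    rw [transition_of_add_one_le δ (show i + 1 ≤ i + (m + 1 : ℕ) by push_cast; omega),
      transition_of_add_one_le δ (show i + 1 ≤ l by push_cast at h'; omega)]
    have key : ∀ (j : ℤ) (_ : j = i + 1 + m) (h : i + 1 ≤ j) (h' : j ≤ l) (y : V (i + 1)),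
        transition δ h' (transition δ h y) = transition δ (h.trans h') y := by
      rintro j rfl h h' y
      exact ih y h h'
    exact key _ (by push_cast; ring) _ _ _

theorem map_transition {i j : ℤ} (h : i ≤ j) (x : V i) :
    δ j (transition δ h x) = transition δ (show i ≤ j + 1 by omega) x := by
  rw [← transition_add_one, transition_transition]

/-- The subspace of `V i` consisting of the elements that come from `V a`; by convention it is
everything if `a > i`. -/
def imageFrom (i a : ℤ) : Submodule k (V i) :=
  if h : a ≤ i then LinearMap.range (transition δ h) else ⊤

theorem mem_imageFrom {i a : ℤ} (h : a ≤ i) {x : V i} :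
    x ∈ imageFrom δ i a ↔ ∃ y, transition δ h y = x := by
  simp [imageFrom, h]

theorem imageFrom_eq_top {i a : ℤ} (h : i ≤ a) : imageFrom δ i a = ⊤ := by
  rcases h.eq_or_lt with rfl | h
  · exact top_unique fun x _ => (mem_imageFrom δ le_rfl).2 ⟨x, transition_self δ _ x⟩
  · simp [imageFrom, h]

theorem imageFrom_mono (i : ℤ) : Monotone (imageFrom δ i) := by
  intro a b hab x hx
  by_cases hb : b ≤ i
  · obtain ⟨y, rfl⟩ := (mem_imageFrom δ (hab.trans hb)).1 hx
    exact (mem_imageFrom δ hb).2 ⟨transition δ hab y, transition_transition δ _ _ _⟩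
  · rw [imageFrom_eq_top δ (by omega)]; trivial

/-- The chain condition on images: inside the kernel of each structure map, the images from degrees
tending to `-∞` become constant. -/
def ImagesStabilize : Prop :=
  ∀ j : ℤ, ∃ a₀ ≤ j, ∀ a ≤ a₀,
    imageFrom δ j a ⊓ LinearMap.ker (δ j) = imageFrom δ j a₀ ⊓ LinearMap.ker (δ j)

/-- Every element is killed by a composite of structure maps; equivalently, the colimit of the
sequence vanishes. -/
def LocallyNilpotent : Prop :=
  ∀ (i : ℤ) (x : V i), ∃ (j : ℤ) (h : i ≤ j), transition δ h x = 0

variable {δ}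

theorem imagesStabilize_of_surjective {n : ℤ} (hn : ∀ i < n, Function.Surjective (δ i)) :
    ImagesStabilize δ := by
  have surj : ∀ (m : ℕ) (a b : ℤ) (h : a + m = b) (_ : b ≤ n),
      Function.Surjective (transitionAux δ m a b h) := by
    intro m
    induction m with
    | zero =>
      intro a b h _
      obtain rfl : a = b := by simpa using h
      exact fun x => ⟨x, rfl⟩
    | succ m ih =>
      intro a b h hb
      have hm := ih (a + 1) b (by push_cast at h; omega) hb
      exact hm.comp (hn a (by omega))
  intro j
  refine ⟨min j n, min_le_left _ _, fun a ha => ?_⟩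
  congr 1
  refine le_antisymm (imageFrom_mono δ j ha) fun x hx => ?_
  obtain ⟨y, rfl⟩ := (mem_imageFrom δ (min_le_left j n)).1 hx
  obtain ⟨z, rfl⟩ : ∃ z, transition δ ha z = y := by
    rw [transition_eq_aux δ (min j n - a).toNat (by omega)]
    exact surj _ _ _ _ (min_le_right _ _) y
  exact (mem_imageFrom δ (by omega)).2 ⟨z, (transition_transition δ _ _ _).symm⟩

theorem imagesStabilize_of_finite_ker (h : ∀ i, Module.Finite k (LinearMap.ker (δ i))) :
    ImagesStabilize δ := by
  intro j
  -- the descending chain condition in the finite-dimensional space `ker (δ j)`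
  let G : ℕ →o (Submodule k (LinearMap.ker (δ j)))ᵒᵈ :=
    ⟨fun m => OrderDual.toDual ((imageFrom δ j (j - m)).comap (LinearMap.ker (δ j)).subtype),
      fun m m' hm => Submodule.comap_mono (imageFrom_mono δ j (by omega))⟩
  have := h j
  obtain ⟨m, hm⟩ := monotone_stabilizes_iff_artinian.2
    (inferInstance : IsArtinian k (LinearMap.ker (δ j))) G
  refine ⟨j - m, by omega, fun a ha => ?_⟩
  have e := hm (j - a).toNat (by omega)
  have e' : (imageFrom δ j (j - m)).comap (LinearMap.ker (δ j)).subtype =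
      (imageFrom δ j (j - ((j - a).toNat : ℕ))).comap (LinearMap.ker (δ j)).subtype := e
  rw [show j - ((j - a).toNat : ℕ) = a by omega] at e'
  have e'' := congrArg (Submodule.map (LinearMap.ker (δ j)).subtype) e'
  rw [Submodule.map_comap_subtype, Submodule.map_comap_subtype] at e''
  rw [inf_comm, ← e'', inf_comm]

/-- Under the chain condition, an element of `V (j + 1)` lying in all images has a preimage in `V j`
lying in all images. -/
theorem ImagesStabilize.exists_preimage (hL : ImagesStabilize δ) {j : ℤ} {y : V (j + 1)}
    (hy : ∀ a, y ∈ imageFrom δ (j + 1) a) : ∃ x, δ j x = y ∧ ∀ a, x ∈ imageFrom δ j a := by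
  obtain ⟨a₀, ha₀, h⟩ := hL j
  obtain ⟨z, hz⟩ := (mem_imageFrom δ (by omega)).1 (hy a₀)
  have hzm : transition δ ha₀ z ∈ imageFrom δ j a₀ := (mem_imageFrom δ ha₀).2 ⟨z, rfl⟩
  refine ⟨transition δ ha₀ z, by rw [map_transition, hz], fun a => ?_⟩
  rcases le_total a₀ a with ha | ha
  · exact imageFrom_mono δ j ha hzm
  -- any preimage coming from `V a` differs from the chosen one by an element of the kernel
  obtain ⟨z', hz'⟩ := (mem_imageFrom δ (by omega)).1 (hy a)
  have hx' : transition δ (ha.trans ha₀) z' ∈ imageFrom δ j a :=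
    (mem_imageFrom δ _).2 ⟨z', rfl⟩
  have hd : transition δ ha₀ z - transition δ (ha.trans ha₀) z' ∈
      imageFrom δ j a₀ ⊓ LinearMap.ker (δ j) := by
    refine ⟨sub_mem hzm (imageFrom_mono δ j ha hx'), ?_⟩
    change δ j _ = 0
    rw [map_sub, map_transition, map_transition, hz, hz', sub_self]
  rw [← h a ha] at hd
  simpa using add_mem hd.1 hx'

/-- Every element `c` of `V i` is the last member of a chain of preimages which starts as early as
the position of `c` in the filtration by images allows. -/
theorem ImagesStabilize.exists_chain (hL : ImagesStabilize δ) {i : ℤ} (c : V i) :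
    ∃ (a : WithBot ℤ) (e : ∀ j : ℤ, V j), a ≤ (i : WithBot ℤ) ∧
      (∀ (j : ℤ) (h : j ≤ i), a ≤ (j : WithBot ℤ) → transition δ h (e j) = c) ∧
      (∀ j : ℤ, a ≤ (j : WithBot ℤ) → j < i → δ j (e j) = e (j + 1)) ∧
      (∀ j : ℤ, j ≤ i → c ∈ imageFrom δ i j → a ≤ (j : WithBot ℤ)) := by
  classical
  by_cases hc : ∀ a, c ∈ imageFrom δ i a
  -- `c` lies in all images: the chain is infinite, and is built by lifting step by step
  · have step : ∀ (j j' : ℤ) (h : j' = j + 1) (y : V j'), (∀ a, y ∈ imageFrom δ j' a) →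
        ∃ x, transition δ (show j ≤ j' by omega) x = y ∧ ∀ a, x ∈ imageFrom δ j a := by
      rintro j _ rfl y hy
      obtain ⟨x, hx, hx'⟩ := hL.exists_preimage hy
      exact ⟨x, by rw [transition_add_one, hx], hx'⟩
    choose! lift lift_eq lift_mem using step
    let E : (m : ℕ) → V (i - m) := fun m =>
      Nat.rec (motive := fun m => V (i - m)) (transition δ (by simp) c)
        (fun m x => lift (i - (m + 1 : ℕ)) (i - m) x) m
    have E_mem : ∀ (m : ℕ) (a : ℤ), E m ∈ imageFrom δ (i - m) a := by
      intro m
      induction m with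
      | zero =>
        intro a
        have : ∀ j (h : i = j), transition δ h.le c ∈ imageFrom δ j a := by
          rintro j rfl
          rw [transition_self]
          exact hc a
        exact this _ (by simp)
      | succ m ih => exact lift_mem _ _ (by push_cast; omega) _ ih
    have E_succ : ∀ m : ℕ, transition δ (by push_cast; omega) (E (m + 1)) = E m := fun m =>
      lift_eq _ _ (by push_cast; omega) _ (E_mem m)
    have E_trans : ∀ m : ℕ, transition δ (by omega) (E m) = c := by
      intro m
      induction m with
      | zero =>
        change transition δ _ (transition δ _ c) = c
        rw [transition_transition, transition_self]
      | succ m ih => rw [← ih, ← E_succ m, transition_transition]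
    refine ⟨⊥, fun j => transition δ (show i - (i - j).toNat ≤ j by omega) (E (i - j).toNat),
      bot_le, fun j h _ => by rw [transition_transition, E_trans], fun j _ hj => ?_,
      fun _ _ _ => bot_le⟩
    obtain ⟨m, hm⟩ : ∃ m : ℕ, (i - (j + 1)).toNat = m := ⟨_, rfl⟩
    have hm' : (i - j).toNat = m + 1 := by omega
    have key : ∀ m' (h : m' = m + 1) (h' : i - (m' : ℕ) ≤ j + 1),
        transition δ h' (E m') = transition δ (by omega) (E m) := by
      rintro _ rfl h'
      rw [← E_succ m, transition_transition]
    dsimp only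
    rw [map_transition]
    subst hm
    exact key _ hm' _
  · push Not at hc
    -- otherwise the chain starts in the least degree `a` such that `c` comes from `V a`
    obtain ⟨a', ha'⟩ := hc
    obtain ⟨a, ha, hmin⟩ := Int.exists_least_of_bdd (P := fun a => c ∈ imageFrom δ i a)
      ⟨a', fun z hz => by
        by_contra hlt
        exact ha' (imageFrom_mono δ i (by omega) hz)⟩
      ⟨i, by rw [imageFrom_eq_top δ le_rfl]; trivial⟩
    have hai : a ≤ i := hmin i (by rw [imageFrom_eq_top δ le_rfl]; trivial)
    obtain ⟨z, hz⟩ := (mem_imageFrom δ hai).1 ha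
    refine ⟨a, fun j => if h : a ≤ j then transition δ h z else 0, by exact_mod_cast hai,
      fun j h h' => ?_, fun j h h' => ?_, fun j hj h => by exact_mod_cast hmin j h⟩
    · dsimp only
      rw [dif_pos (by exact_mod_cast h'), transition_transition, hz]
    · have h : a ≤ j := by exact_mod_cast h
      dsimp only
      rw [dif_pos h, dif_pos (by omega), map_transition]

end Transition

/-! ### Adapted bases and bases of chains -/

/-- The union of an increasing filtration which becomes constant towards `-∞` has a basis containing
a basis of each member of the filtration. -/
theorem exists_adapted_basis {W : Type*} [AddCommGroup W] [Module k W] (G : ℤ → Submodule k W)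
    (hG : Monotone G) (a₀ : ℤ) (h₀ : ∀ a ≤ a₀, G a = G a₀) :
    ∃ B : Set W, LinearIndepOn k id B ∧ B ⊆ ⋃ a, G a ∧
      ∀ a, G a ≤ Submodule.span k (B ∩ G a) := by
  have base : ∃ s : Set W, LinearIndepOn k id s ∧ s ⊆ G a₀ ∧ (G a₀ : Set W) ⊆ Submodule.span k s :=
    ⟨(linearIndepOn_empty k id).extend (Set.empty_subset (G a₀ : Set W)),
      LinearIndepOn.linearIndepOn_extend _ _, LinearIndepOn.extend_subset _ _,
      by
        have := LinearIndepOn.subset_span_extend (linearIndepOn_empty k id)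
          (Set.empty_subset (G a₀ : Set W))
        simpa only [Set.image_id] using this⟩
  obtain ⟨s₀, hs₀, hs₀', hs₀''⟩ := base
  let S : (m : ℕ) → {s : Set W // LinearIndepOn k id s ∧ s ⊆ G (a₀ + m)} := fun m =>
    Nat.rec (motive := fun m => {s : Set W // LinearIndepOn k id s ∧ s ⊆ G (a₀ + m)})
      ⟨s₀, hs₀, by simpa using hs₀'⟩
      (fun m s => ⟨s.2.1.extend (t := (G (a₀ + (m + 1 : ℕ)) : Set W))
        (s.2.2.trans (hG (by push_cast; omega))),
        LinearIndepOn.linearIndepOn_extend _ _, LinearIndepOn.extend_subset _ _⟩) m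
  have hS : ∀ m : ℕ, (S m).1 ⊆ G (a₀ + (m + 1 : ℕ)) := fun m =>
    (S m).2.2.trans (hG (by push_cast; omega))
  have S_mono : Monotone fun m => (S m).1 := monotone_nat_of_le_succ fun m =>
    LinearIndepOn.subset_extend (S m).2.1 (hS m)
  have S_span : ∀ m : ℕ, (G (a₀ + m) : Set W) ⊆ Submodule.span k (S m).1 := by
    intro m
    cases m with
    | zero =>
      change (G (a₀ + (0 : ℕ)) : Set W) ⊆ Submodule.span k s₀
      simpa using hs₀''
    | succ m =>
      have := LinearIndepOn.subset_span_extend (S m).2.1 (hS m)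
      simpa only [Set.image_id] using this
  refine ⟨⋃ m, (S m).1, linearIndepOn_iUnion_of_directed S_mono.directed_le fun m => (S m).2.1,
    Set.iUnion_subset fun m => (S m).2.2.trans (Set.subset_iUnion (fun a => (G a : Set W)) _),
    fun a => ?_⟩
  have key : ∀ m : ℕ, G (a₀ + m) ≤ Submodule.span k ((⋃ m, (S m).1) ∩ G (a₀ + m)) := fun m =>
    le_trans (S_span m) (Submodule.span_mono
      (Set.subset_inter (Set.subset_iUnion (fun m => (S m).1) m) (S m).2.2))
  rcases le_total a a₀ with ha | ha
  · rw [h₀ a ha]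
    simpa using key 0
  · have := key (a - a₀).toNat
    rwa [show a₀ + ((a - a₀).toNat : ℕ) = a by omega] at this

section Decomposition

variable {V : ℤ → Type u} [∀ i, AddCommGroup (V i)] [∀ i, Module k (V i)]
  {δ : ∀ i, V i →ₗ[k] V (i + 1)}

/-- A locally nilpotent sequence satisfying the chain condition on images has a basis consisting of
chains. The chain with index `p` lives in the degrees from `a p` to `b p`; in each degree `i` the
members of degree `i` of the chains that pass through `i` form a basis of `V i`. -/
theorem ImagesStabilize.exists_chain_basis (hL : ImagesStabilize δ) (hN : LocallyNilpotent δ) :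
    ∃ (J : Type u) (a : J → WithBot ℤ) (b : J → ℤ) (e : ∀ (_ : J) (i : ℤ), V i),
      (∀ p, a p ≤ (b p : WithBot ℤ)) ∧
      (∀ p (i : ℤ), a p ≤ (i : WithBot ℤ) → i < b p → δ i (e p i) = e p (i + 1)) ∧
      (∀ p, δ (b p) (e p (b p)) = 0) ∧
      ∀ i : ℤ, LinearIndependent k
          (fun p : {p : J // a p ≤ (i : WithBot ℤ) ∧ i ≤ b p} => e p.1 i) ∧
        ⊤ ≤ Submodule.span k
          (Set.range fun p : {p : J // a p ≤ (i : WithBot ℤ) ∧ i ≤ b p} => e p.1 i) := by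
  classical
  have hB : ∀ i, ∃ B : Set (V i), LinearIndepOn k id B ∧ B ⊆ LinearMap.ker (δ i) ∧
      ∀ a, imageFrom δ i a ⊓ LinearMap.ker (δ i) ≤ Submodule.span k (B ∩ imageFrom δ i a) := by
    intro i
    obtain ⟨a₀, -, h₀⟩ := hL i
    obtain ⟨B, hB, hB', hB''⟩ := exists_adapted_basis
      (fun a => imageFrom δ i a ⊓ LinearMap.ker (δ i))
      (fun a b hab => inf_le_inf_right _ (imageFrom_mono δ i hab)) a₀ h₀
    exact ⟨B, hB, hB'.trans (Set.iUnion_subset fun a => inf_le_right), fun a => (hB'' a).trans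
      (Submodule.span_mono (Set.inter_subset_inter_right _ inf_le_left))⟩
  choose B B_indep B_ker B_span using hB
  choose a e a_le e_trans e_succ a_min using fun i (c : V i) => hL.exists_chain c
  have e_self : ∀ i c, e i c i = c := fun i c => by
    rw [← transition_self δ i (e i c i)]
    exact e_trans i c i le_rfl (a_le i c)
  refine ⟨Σ i, B i, fun p => a p.1 p.2, fun p => p.1, fun p => e p.1 p.2, fun p => a_le _ _,
    fun p i h h' => e_succ _ _ i h h', fun p => ?_, fun i => ⟨?_, ?_⟩⟩
  · dsimp only
    rw [e_self]
    exact B_ker _ p.2.2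
  -- In a relation between chains, apply the transition map to the last degree in which one of the
  -- chains involved ends: the others die, and what remains is a relation inside `B`.
  · rw [linearIndependent_iff']
    intro s g hg
    by_contra! hne
    obtain ⟨p₀, hp₀s, hp₀⟩ := hne
    obtain ⟨p, hp, hmax⟩ := Finset.exists_max_image (s.filter fun p => g p ≠ 0)
      (fun p => p.1.1) ⟨p₀, by simp [hp₀s, hp₀]⟩
    rw [Finset.mem_filter] at hp
    obtain ⟨b, hb⟩ : ∃ b, b = p.1.1 := ⟨_, rfl⟩
    have hbi : i ≤ b := hb ▸ p.2.2
    let f : {p : Σ i, B i // a p.1 p.2 ≤ (i : WithBot ℤ) ∧ i ≤ p.1} → V b :=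
      fun q => transition δ hbi (e q.1.1 q.1.2 i)
    have hf : ∀ (c : B b) (hc : a b c ≤ (i : WithBot ℤ) ∧ i ≤ b), f ⟨⟨b, c⟩, hc⟩ = c :=
      fun c hc => e_trans _ _ _ _ hc.1
    have f_indep : LinearIndepOn k f {q | q.1.1 = b} := by
      rw [linearIndepOn_iff_image]
      · refine (B_indep b).mono ?_
        rintro _ ⟨⟨⟨b', c⟩, hc⟩, h, rfl⟩
        obtain rfl : b' = b := h
        rw [hf]
        exact c.2
      · rintro ⟨⟨b', c⟩, hc⟩ h ⟨⟨b'', c'⟩, hc'⟩ h' hcc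
        obtain rfl : b' = b := h
        obtain rfl : b'' = b' := h'
        rw [hf, hf] at hcc
        obtain rfl := Subtype.ext hcc
        rfl
    have h2 : ∑ q ∈ s.filter (fun q => q.1.1 = b), g q • f q = 0 := by
      rw [← map_zero (transition δ hbi), ← hg, map_sum, Finset.sum_filter]
      refine Finset.sum_congr rfl fun q hq => ?_
      rw [map_smul]
      split_ifs with hqb
      · rfl
      · by_cases hq0 : g q = 0
        · simp [hq0]
        have hlt : q.1.1 < b := by
          have := hmax q (by simp [hq, hq0])
          omega
        rw [← transition_transition δ q.2.2 hlt.le, e_trans _ _ _ _ q.2.1,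
          transition_of_add_one_le δ (by omega : q.1.1 + 1 ≤ b),
          LinearMap.mem_ker.1 (B_ker _ q.1.2.2)]
        simp
    exact hp.2 (linearIndepOn_iff'.1 f_indep _ g (fun q hq => (Finset.mem_filter.1 hq).2) h2 p
      (Finset.mem_filter.2 ⟨hp.1, hb.symm⟩))
  -- Induction on the number of structure maps needed to kill the element: subtracting a
  -- combination of chains that end in the last degree where the image survives lowers it.
  · have key : ∀ (m : ℕ) (x : V i), transition δ (show i ≤ i + m by omega) x = 0 →
        x ∈ Submodule.span k (Set.range
          fun p : {p : Σ i, B i // a p.1 p.2 ≤ (i : WithBot ℤ) ∧ i ≤ p.1} => e p.1.1 p.1.2 i) := by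
      intro m
      induction m with
      | zero =>
        intro x hx
        have : ∀ j (h : i = j), transition δ h.le x = 0 → x = 0 := by
          rintro j rfl h
          rwa [transition_self] at h
        rw [this _ (by simp) hx]
        exact zero_mem _
      | succ m ih =>
        intro x hx
        have him : i ≤ i + m := by omega
        have hy : transition δ him x ∈ imageFrom δ (i + m) i ⊓ LinearMap.ker (δ (i + m)) := by
          refine ⟨(mem_imageFrom δ him).2 ⟨x, rfl⟩, ?_⟩
          change δ _ _ = 0
          rw [map_transition]
          have : ∀ j (_ : j = i + (m + 1 : ℕ)) (h : i ≤ j), transition δ h x = 0 := by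
            rintro _ rfl h
            exact hx
          exact this _ (by push_cast; ring) _
        have hz : transition δ him x ∈ (Submodule.span k (Set.range
            fun p : {p : Σ i, B i // a p.1 p.2 ≤ (i : WithBot ℤ) ∧ i ≤ p.1} =>
              e p.1.1 p.1.2 i)).map (transition δ him) := by
          refine Submodule.span_le.2 ?_ (B_span _ _ hy)
          rintro c ⟨hc, hci⟩
          have hai := a_min (i + m) c i him hci
          exact ⟨e (i + m) c i, Submodule.subset_span ⟨⟨⟨i + m, c, hc⟩, hai, him⟩, rfl⟩,
            e_trans _ _ _ _ hai⟩
        obtain ⟨z, hz, hzx⟩ := hz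
        have := ih (x - z) (by rw [map_sub, hzx, sub_self])
        simpa using add_mem this hz
    intro x _
    obtain ⟨j, hj, hx⟩ := hN i x
    obtain ⟨m, rfl⟩ : ∃ m : ℕ, j = i + m := ⟨(j - i).toNat, by omega⟩
    exact key m x hx

end Decomposition
end LinearAlgebra

/-! ### Extension of scalars to the dual numbers -/

section DualNumbers

variable {k : Type u} [Field k]

/-- The extension of scalars of a `k`-module to the dual numbers. -/
noncomputable abbrev dualExt (M : CommModuleCat k) : ModDual k :=
  (ModuleCat.extendScalars (algebraMap k (DualNumber k))).obj M

open scoped ChangeOfRings in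
/-- The element `s ⊗ x`. -/
noncomputable def dualTmul {M : CommModuleCat k} (s : DualNumber k) (x : M) : dualExt M :=
  s ⊗ₜ[k,algebraMap k (DualNumber k)] x

/-- The additive map `s ⊗ x ↦ ρ s • x` defined by a `k`-linear functional `ρ` on the dual
numbers. -/
noncomputable def dualExtCoeff (ρ : DualNumber k →ₗ[k] k) (M : CommModuleCat k) :
    dualExt M →+ M :=
  letI : Module k (DualNumber k) := Module.compHom _ (algebraMap k (DualNumber k))
  (TensorProduct.lift
    ({ toFun := fun s => ρ s • LinearMap.id
       map_add' := fun s t => by rw [map_add, add_smul]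
       map_smul' := fun r s => by
        change ρ (algebraMap k (DualNumber k) r * s) • _ = _
        rw [← Algebra.smul_def, map_smul, smul_assoc]
        rfl } : DualNumber k →ₗ[k] M →ₗ[k] M)).toAddMonoidHom

theorem smul_dualTmul {M : CommModuleCat k} (r s : DualNumber k) (x : M) :
    r • dualTmul s x = dualTmul (r * s) x :=
  rfl

theorem map_dualTmul {M N : CommModuleCat k} (f : M ⟶ N) (s : DualNumber k) (x : M) :
    (ModuleCat.extendScalars (algebraMap k (DualNumber k))).map f (dualTmul s x) =
      dualTmul s (f x) :=
  rfl

theorem dualExtCoeff_dualTmul (ρ : DualNumber k →ₗ[k] k) (M : CommModuleCat k) (s : DualNumber k)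
    (x : M) : dualExtCoeff ρ M (dualTmul s x) = ρ s • x :=
  rfl

/-- The element `1 ⊗ x`. -/
noncomputable def oneTmul {M : CommModuleCat k} (x : M) : dualExt M :=
  dualTmul 1 x

/-- The constant coefficient `x` of an element `1 ⊗ x + ε ⊗ y`. -/
noncomputable abbrev constCoeff (M : CommModuleCat k) : dualExt M →+ M :=
  dualExtCoeff (TrivSqZeroExt.fstHom k k k).toLinearMap M

/-- The coefficient `y` of `ε` in an element `1 ⊗ x + ε ⊗ y`. -/
noncomputable abbrev epsCoeff (M : CommModuleCat k) : dualExt M →+ M :=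
  dualExtCoeff (TrivSqZeroExt.sndHom k k) M

theorem dualExt_induction {M : CommModuleCat k} {p : dualExt M → Prop} (z : dualExt M)
    (zero : p 0) (tmul : ∀ s x, p (dualTmul s x))
    (add : ∀ y z, p y → p z → p (y + z)) : p z :=
  letI : Module k (DualNumber k) := Module.compHom _ (algebraMap k (DualNumber k))
  TensorProduct.induction_on (motive := p) z zero tmul add

theorem constCoeff_smul {M : CommModuleCat k} (r : DualNumber k) (z : dualExt M) :
    constCoeff M (r • z) = r.fst • constCoeff M z := by
  induction z using dualExt_induction with
  | zero => simp
  | tmul s x =>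
    rw [smul_dualTmul, dualExtCoeff_dualTmul, dualExtCoeff_dualTmul, smul_smul]
    simp
  | add y z hy hz =>
    rw [smul_add, map_add, map_add, hy, hz, smul_add]

theorem epsCoeff_smul {M : CommModuleCat k} (r : DualNumber k) (z : dualExt M) :
    epsCoeff M (r • z) = r.fst • epsCoeff M z + r.snd • constCoeff M z := by
  induction z using dualExt_induction with
  | zero => simp
  | tmul s x =>
    rw [smul_dualTmul, dualExtCoeff_dualTmul, dualExtCoeff_dualTmul, dualExtCoeff_dualTmul,
      smul_smul, smul_smul, ← add_smul]
    simp [mul_comm]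
  | add y z hy hz =>
    rw [smul_add, map_add, map_add, hy, hz, map_add, smul_add, smul_add]
    abel

theorem constCoeff_oneTmul {M : CommModuleCat k} (x : M) : constCoeff M (oneTmul x) = x := by
  rw [oneTmul, dualExtCoeff_dualTmul]
  simp

theorem map_oneTmul {M N : CommModuleCat k} (f : M ⟶ N) (x : M) :
    (ModuleCat.extendScalars (algebraMap k (DualNumber k))).map f (oneTmul x) = oneTmul (f x) :=
  map_dualTmul f _ _

theorem oneTmul_add {M : CommModuleCat k} (x y : M) : oneTmul (x + y) = oneTmul x + oneTmul y :=
  letI : Module k (DualNumber k) := Module.compHom _ (algebraMap k (DualNumber k))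
  TensorProduct.tmul_add (R := k) (1 : DualNumber k) x y

theorem oneTmul_zero {M : CommModuleCat k} : oneTmul (0 : M) = 0 := by
  have := oneTmul_add (0 : M) 0
  rwa [add_zero, left_eq_add] at this

theorem oneTmul_smul {M : CommModuleCat k} (r : k) (x : M) :
    oneTmul (r • x) = algebraMap k (DualNumber k) r • oneTmul x := by
  let : Module k (DualNumber k) := Module.compHom _ (algebraMap k (DualNumber k))
  rw [oneTmul, oneTmul, smul_dualTmul]
  exact (TensorProduct.smul_tmul (R := k) (M := (ModuleCat.restrictScalars
    (algebraMap k (DualNumber k))).obj (ModuleCat.of _ (DualNumber k)))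
    r (1 : DualNumber k) x).symm

theorem eq_oneTmul_add_eps_smul {M : CommModuleCat k} (z : dualExt M) :
    z = oneTmul (constCoeff M z) + (DualNumber.eps : DualNumber k) • oneTmul (epsCoeff M z) := by
  induction z using dualExt_induction with
  | zero => simp [oneTmul_zero]
  | tmul s x =>
    rw [dualExtCoeff_dualTmul, dualExtCoeff_dualTmul, oneTmul_smul, oneTmul_smul, smul_smul, ← add_smul,
      oneTmul, smul_dualTmul]
    congr 1
    ext <;> simp [TrivSqZeroExt.algebraMap_eq_inl]
  | add y z hy hz =>
    conv_lhs => rw [hy, hz]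
    rw [map_add, map_add, oneTmul_add, oneTmul_add, smul_add]
    abel

theorem eps_smul_oneTmul_injective {M : CommModuleCat k} {x y : M}
    (h : (DualNumber.eps : DualNumber k) • oneTmul x =
      (DualNumber.eps : DualNumber k) • oneTmul y) :
    x = y := by
  have := congrArg (epsCoeff M) h
  rw [epsCoeff_smul, epsCoeff_smul, constCoeff_oneTmul, constCoeff_oneTmul] at this
  simpa using this

end DualNumbers

/-! ### Cohomology and null-homotopies of minimal complexes -/

section MinimalComplex

variable {k : Type u} [Field k]

theorem minimalComplex_d (V : SeqVect k) (i : ℤ) :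
    (minimalComplex V).d i (i + 1) = (DualNumber.eps : DualNumber k) •
      (ModuleCat.extendScalars (algebraMap k (DualNumber k))).map (V.δ i) := by
  dsimp only [minimalComplex, CochainComplex.of]
  rw [CochainComplex.of_d]

theorem minimalComplex_d_apply (V : SeqVect k) (i : ℤ) (z : dualExt (V.X i)) :
    (minimalComplex V).d i (i + 1) z =
      (DualNumber.eps : DualNumber k) • oneTmul (V.δ i (constCoeff _ z)) := by
  rw [minimalComplex_d]
  change (DualNumber.eps : DualNumber k) •
    (ModuleCat.extendScalars (algebraMap k (DualNumber k))).map (V.δ i) z = _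
  conv_lhs => rw [eq_oneTmul_add_eps_smul z]
  rw [map_add, map_smul, smul_add, smul_smul, DualNumber.eps_mul_eps, zero_smul, add_zero,
    map_oneTmul]

theorem minimalComplex_exactAt_iff (V : SeqVect k) (i : ℤ) :
    (minimalComplex V).ExactAt (i + 1) ↔ ∀ z : dualExt (V.X (i + 1)),
      (minimalComplex V).d (i + 1) (i + 1 + 1) z = 0 →
        ∃ y : dualExt (V.X i), (minimalComplex V).d i (i + 1) y = z := by
  rw [HomologicalComplex.exactAt_iff' _ i (i + 1) (i + 1 + 1) (by simp) (by simp),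
    ShortComplex.moduleCat_exact_iff]
  rfl

/-- All elements `ε ⊗ y` are cocycles, and they are coboundaries only for `y` in the image of the
structure map. -/
theorem surjective_of_exactAt {V : SeqVect k} {i : ℤ} (h : (minimalComplex V).ExactAt (i + 1)) :
    Function.Surjective (V.δ i) := by
  intro y
  obtain ⟨z, hz⟩ := (minimalComplex_exactAt_iff V i).1 h
    ((DualNumber.eps : DualNumber k) • oneTmul y) (by
      rw [minimalComplex_d_apply, constCoeff_smul, DualNumber.fst_eps, zero_smul, map_zero,
        oneTmul_zero, smul_zero]
      rfl)
  rw [minimalComplex_d_apply] at hz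
  exact ⟨_, eps_smul_oneTmul_injective hz⟩

/-- A finite set of generators of the cohomology lifts to cocycles whose constant coefficients
generate the kernel of the structure map. -/
theorem finite_ker_of_finite_homology {V : SeqVect k} {i : ℤ}
    (h : Module.Finite (DualNumber k) ((minimalComplex V).homology (i + 1))) :
    Module.Finite k (LinearMap.ker (V.δ (i + 1)).hom) := by
  let C := minimalComplex V
  let S := C.sc' i (i + 1) (i + 1 + 1)
  have e : C.homology (i + 1) ≅ S.moduleCatLeftHomologyData.H :=
    ShortComplex.homologyMapIso (C.isoSc' i (i + 1) (i + 1 + 1) (by simp) (by simp)) ≪≫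
      S.moduleCatHomologyIso
  let R : Submodule (DualNumber k) (LinearMap.ker S.g.hom) := LinearMap.range S.moduleCatToCycles
  have hfin : Module.Finite (DualNumber k) (LinearMap.ker S.g.hom ⧸ R) :=
    Module.Finite.equiv (R := DualNumber k) e.toLinearEquiv
  obtain ⟨t, ht⟩ := hfin.fg_top
  obtain ⟨z, hz⟩ : ∃ z : (LinearMap.ker S.g.hom ⧸ R) → LinearMap.ker S.g.hom,
      ∀ q, R.mkQ (z q) = q :=
    ⟨_, Function.surjInv_eq R.mkQ_surjective⟩
  let co : LinearMap.ker S.g.hom → V.X (i + 1) := fun w => constCoeff (V.X (i + 1)) w.1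
  let N : Submodule k (V.X (i + 1)) := Submodule.span k ((fun q => co (z q)) '' t)
  have hN : Module.Finite k N := Module.Finite.span_of_finite k (t.finite_toSet.image _)
  have hle : LinearMap.ker (V.δ (i + 1)).hom ≤ N := by
    intro x hx
    have hx' : oneTmul x ∈ LinearMap.ker S.g.hom := by
      change C.d (i + 1) (i + 1 + 1) (oneTmul x) = 0
      rw [minimalComplex_d_apply, constCoeff_oneTmul]
      have : V.δ (i + 1) x = 0 := hx
      rw [this, oneTmul_zero, smul_zero]
      rfl
    have h1 : R.mkQ ⟨oneTmul x, hx'⟩ ∈ Submodule.span (DualNumber k) (t : Set _) := ht ▸ trivial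
    have h2 : ∀ q ∈ Submodule.span (DualNumber k) (t : Set (LinearMap.ker S.g.hom ⧸ R)),
        ∃ w, R.mkQ w = q ∧ co w ∈ N := by
      intro q hq
      induction hq using Submodule.span_induction with
      | mem q hq => exact ⟨z q, hz q, Submodule.subset_span ⟨q, hq, rfl⟩⟩
      | zero => exact ⟨0, map_zero _, by
          change constCoeff _ 0 ∈ N
          rw [map_zero]
          exact zero_mem _⟩
      | add q q' _ _ h h' =>
        obtain ⟨w, rfl, hw⟩ := h
        obtain ⟨w', rfl, hw'⟩ := h'
        have e : co (w + w') = co w + co w' := map_add (constCoeff (V.X (i + 1))) w.1 w'.1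
        exact ⟨w + w', map_add _ _ _, e ▸ add_mem hw hw'⟩
      | smul r q _ h =>
        obtain ⟨w, rfl, hw⟩ := h
        have e : co (r • w) = r.fst • co w := constCoeff_smul r w.1
        exact ⟨r • w, map_smul _ _ _, e ▸ N.smul_mem _ hw⟩
    obtain ⟨w, hw, hwN⟩ := h2 _ h1
    obtain ⟨y, hy⟩ := (Submodule.Quotient.eq R).1 hw
    let w₀ : dualExt (V.X (i + 1)) := w.1
    have hy' : (DualNumber.eps : DualNumber k) • oneTmul (V.δ i (constCoeff _ y)) =
        w₀ - oneTmul x :=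
      (minimalComplex_d_apply V i y).symm.trans (congrArg Subtype.val hy)
    have := congrArg (constCoeff (V.X (i + 1))) hy'
    rw [constCoeff_smul, map_sub, DualNumber.fst_eps, zero_smul, eq_comm, sub_eq_zero] at this
    rw [← constCoeff_oneTmul x, ← this]
    exact hwN
  exact Module.Finite.of_injective (Submodule.inclusion hle) (Submodule.inclusion_injective hle)

/-- The morphism of minimal complexes induced by a morphism of sequences. -/
noncomputable def minimalComplexMap {V W : SeqVect k} (φ : V ⟶ W) :
    minimalComplex V ⟶ minimalComplex W :=
  CochainComplex.ofHom
    (fun i => (ModuleCat.extendScalars (algebraMap k (DualNumber k))).map (φ.f i))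
    (fun i => by
      rw [minimalComplex_d, minimalComplex_d]
      have := congrArg (ModuleCat.extendScalars (algebraMap k (DualNumber k))).map (φ.comm i)
      rw [Functor.map_comp, Functor.map_comp] at this
      exact (Linear.comp_smul _ _ _ _ _ _).trans
        ((congrArg ((DualNumber.eps : DualNumber k) • ·) this).trans
          (Linear.smul_comp _ _ _ _ _ _).symm))

/-- Every summand of a null-homotopy between minimal complexes is divisible by `ε`, so that only the
zero morphism of sequences induces a null-homotopic morphism. -/
theorem eq_zero_of_homotopy {V W : SeqVect k} (φ : V ⟶ W)
    (h : Homotopy (minimalComplexMap φ) 0) (i : ℤ) (x : V.X (i + 1)) : φ.f (i + 1) x = 0 := by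
  have h1 := h.comm (i + 1)
  rw [dNext_eq h.hom (show (ComplexShape.up ℤ).Rel (i + 1) (i + 1 + 1) from rfl),
    prevD_eq h.hom (show (ComplexShape.up ℤ).Rel i (i + 1) from rfl)] at h1
  let H : dualExt (V.X (i + 1 + 1)) →ₗ[DualNumber k] dualExt (W.X (i + 1)) :=
    (h.hom (i + 1 + 1) (i + 1)).hom
  let H' : dualExt (V.X (i + 1)) →ₗ[DualNumber k] dualExt (W.X i) := (h.hom (i + 1) i).hom
  let D : dualExt (V.X (i + 1)) →ₗ[DualNumber k] dualExt (V.X (i + 1 + 1)) :=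
    ((minimalComplex V).d (i + 1) (i + 1 + 1)).hom
  let D' : dualExt (W.X i) →ₗ[DualNumber k] dualExt (W.X (i + 1)) :=
    ((minimalComplex W).d i (i + 1)).hom
  have h2 : oneTmul (φ.f (i + 1) x) = H (D (oneTmul x)) + D' (H' (oneTmul x)) + 0 :=
    congrArg (fun f : (minimalComplex V).X (i + 1) ⟶ (minimalComplex W).X (i + 1) =>
      f (oneTmul x)) h1
  have hD : D (oneTmul x) = _ := minimalComplex_d_apply V (i + 1) (oneTmul x)
  have hD' : D' (H' (oneTmul x)) = _ := minimalComplex_d_apply W i (H' (oneTmul x))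
  rw [add_zero, hD, hD', map_smul, ← smul_add] at h2
  have h3 := congrArg (constCoeff (W.X (i + 1))) h2
  rwa [constCoeff_smul, DualNumber.fst_eps, zero_smul, constCoeff_oneTmul] at h3

/-- The constant sequence with all structure maps equal to the identity. -/
def constSeq (U : CommModuleCat k) : SeqVect k where
  X _ := U
  δ _ := 𝟙 U

theorem acyclic_minimalComplex_constSeq (U : CommModuleCat k) :
    (minimalComplex (constSeq U)).Acyclic := by
  intro j
  obtain ⟨i, rfl⟩ : ∃ i, j = i + 1 := ⟨j - 1, by omega⟩
  rw [minimalComplex_exactAt_iff]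
  intro z hz
  rw [minimalComplex_d_apply] at hz
  have h0 : constCoeff U z = 0 := by
    refine eps_smul_oneTmul_injective ?_
    rw [oneTmul_zero, smul_zero]
    exact hz
  have h1 : (DualNumber.eps : DualNumber k) • oneTmul (constCoeff U (oneTmul (epsCoeff U z))) =
      z := by
    rw [constCoeff_oneTmul]
    conv_rhs => rw [eq_oneTmul_add_eps_smul (M := U) z, h0, oneTmul_zero, zero_add]
  exact ⟨oneTmul (M := U) (epsCoeff U z), (minimalComplex_d_apply _ _ _).trans h1⟩

/-- If the minimal complex is h-projective, then the colimit of the sequence vanishes: the minimal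
complex of the constant sequence on the colimit is acyclic, so the canonical morphism to it is
null-homotopic, hence zero. -/
theorem locallyNilpotent_of_isKProjective {V : SeqVect k} (hV : (minimalComplex V).IsKProjective) :
    LocallyNilpotent fun i => (V.δ i).hom := by
  let T : ∀ i j : ℤ, i ≤ j → V.X i →ₗ[k] V.X j := fun i j h => transition (fun i => (V.δ i).hom) h
  have : DirectedSystem (fun i => V.X i) (fun i j h => T i j h) :=
    ⟨fun i x => transition_self (fun i => (V.δ i).hom) i x,
      fun _ _ _ h h' x => transition_transition (fun i => (V.δ i).hom) h h' x⟩
  let U : CommModuleCat k := ModuleCat.of k (Module.DirectLimit (fun i => V.X i) T)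
  let φ : V ⟶ constSeq U :=
    { f := fun i => ModuleCat.ofHom (Module.DirectLimit.of k ℤ (fun i => V.X i) T i)
      comm := fun i => by
        ext x
        change Module.DirectLimit.of k ℤ (fun i => V.X i) T i x =
          Module.DirectLimit.of k ℤ (fun i => V.X i) T (i + 1) ((V.δ i).hom x)
        rw [← Module.DirectLimit.of_f (hij := show i ≤ i + 1 by omega)]
        congr 1
        exact transition_add_one (fun i => (V.δ i).hom) i x }
  obtain ⟨h⟩ := hV.nonempty_homotopy_zero (minimalComplexMap φ) (acyclic_minimalComplex_constSeq U)
  intro i x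
  obtain ⟨i, rfl⟩ : ∃ i', i = i' + 1 := ⟨i - 1, by omega⟩
  exact Module.DirectLimit.of.zero_exact (eq_zero_of_homotopy φ h i x)

end MinimalComplex

/-! ### Zero morphisms of sequences -/

section Sequences

variable {k : Type u} [Field k]

theorem SeqObj.hom_ext {V W : SeqVect k} {p q : V ⟶ W} (h : ∀ i x, p.f i x = q.f i x) : p = q :=
  Hom.ext (funext fun i => ModuleCat.hom_ext (LinearMap.ext (h i)))

theorem SeqObj.comm_apply {V W : SeqVect k} (p : V ⟶ W) (i : ℤ) (x : V.X i) :
    W.δ i (p.f i x) = p.f (i + 1) (V.δ i x) :=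
  congrArg (fun f : V.X i ⟶ W.X (i + 1) => f x) (p.comm i)

noncomputable instance : HasZeroMorphisms (SeqVect k) where
  zero V W := ⟨{ f := fun _ => 0, comm := fun i => by rw [zero_comp, comp_zero] }⟩
  comp_zero p W := SeqObj.hom_ext fun i x => rfl
  zero_comp V _ _ q := SeqObj.hom_ext fun i x => map_zero (q.f i).hom

end Sequences

/-! ### Interval objects -/

section IntervalSeq

variable {k : Type u} [Field k] {a : WithBot ℤ} {b : WithTop ℤ}

theorem intervalSeq_X_of_mem {i : ℤ} (h : InInterval a b i) :
    (intervalSeq k a b).X i = ModuleCat.of k k := if_pos h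

variable (k) in
/-- The generator `1` of the component of `S_{a,b}` in a degree of the interval. -/
noncomputable def intervalGen {i : ℤ} (h : InInterval a b i) : (intervalSeq k a b).X i :=
  eqToHom (intervalSeq_X_of_mem h).symm (1 : k)

theorem eq_smul_intervalGen {i : ℤ} (h : InInterval a b i) (x : (intervalSeq k a b).X i) :
    ∃ r : k, x = r • intervalGen k h := by
  let y : k := eqToHom (intervalSeq_X_of_mem h) x
  refine ⟨y, ?_⟩
  rw [intervalGen, ← map_smul]
  have : y • (1 : k) = y := mul_one y
  rw [this]
  change x = (eqToHom (intervalSeq_X_of_mem h) ≫ eqToHom (intervalSeq_X_of_mem h).symm) x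
  rw [eqToHom_trans, eqToHom_refl]
  rfl

theorem smul_intervalGen_injective {i : ℤ} (h : InInterval a b i) :
    Function.Injective fun r : k => r • intervalGen k h := by
  intro r s hrs
  have := congrArg (eqToHom (intervalSeq_X_of_mem (k := k) h)) hrs
  dsimp only [intervalGen] at this
  rw [← map_smul, ← map_smul] at this
  have key : ∀ t : k, eqToHom (intervalSeq_X_of_mem (k := k) h)
      (eqToHom (intervalSeq_X_of_mem h).symm t) = t := by
    intro t
    change (eqToHom (intervalSeq_X_of_mem (k := k) h).symm ≫ eqToHom (intervalSeq_X_of_mem h)) t = t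
    rw [eqToHom_trans, eqToHom_refl]
    rfl
  rw [key, key] at this
  simpa using this

theorem eq_zero_of_not_mem {i : ℤ} (h : ¬ InInterval a b i) (x : (intervalSeq k a b).X i) :
    x = 0 := by
  have e : (intervalSeq k a b).X i = ModuleCat.of k PUnit := if_neg h
  have : Subsingleton ((intervalSeq k a b).X i) := by
    rw [e]
    exact inferInstanceAs (Subsingleton PUnit)
  exact Subsingleton.elim _ _

theorem intervalSeq_δ_gen {i : ℤ} (h : InInterval a b i) (h' : InInterval a b (i + 1)) :
    (intervalSeq k a b).δ i (intervalGen k h) = i.negOnePow • intervalGen k h' := by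
  have e : (intervalSeq k a b).δ i = eqToHom (if_pos h) ≫ (i.negOnePow • 𝟙 (ModuleCat.of k k)) ≫
    eqToHom (if_pos h').symm := dif_pos ⟨h, h'⟩
  rw [e]
  change (eqToHom (intervalSeq_X_of_mem h).symm ≫ eqToHom (intervalSeq_X_of_mem h) ≫
    (i.negOnePow • 𝟙 (ModuleCat.of k k)) ≫ eqToHom (intervalSeq_X_of_mem h').symm) (1 : k) = _
  rw [eqToHom_trans_assoc, eqToHom_refl, Category.id_comp]
  change eqToHom (intervalSeq_X_of_mem h').symm
    ((i.negOnePow • 𝟙 (ModuleCat.of k k) : ModuleCat.of k k ⟶ ModuleCat.of k k) (1 : k)) = _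
  rw [Units.smul_def, Units.smul_def, intervalGen, ← map_zsmul]
  rfl

/-- Morphisms out of `S_{a,b}` agree if they agree on the generators. -/
theorem intervalSeq_hom_ext {W : SeqVect k} {p q : intervalSeq k a b ⟶ W}
    (hpq : ∀ i (h : InInterval a b i), p.f i (intervalGen k h) = q.f i (intervalGen k h)) :
    p = q := by
  refine SeqObj.hom_ext fun i x => ?_
  by_cases h : InInterval a b i
  · obtain ⟨r, rfl⟩ := eq_smul_intervalGen h x
    rw [map_smul, map_smul, hpq]
  · rw [eq_zero_of_not_mem h x, map_zero, map_zero]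

/-- A chain of elements indexed by the interval defines a morphism out of `S_{a,b}`. -/
theorem exists_intervalSeq_hom {W : SeqVect k} (e : ∀ i, W.X i)
    (he : ∀ i, InInterval a b i → InInterval a b (i + 1) →
      W.δ i (e i) = i.negOnePow • e (i + 1))
    (he' : ∀ i, InInterval a b i → ¬ InInterval a b (i + 1) → W.δ i (e i) = 0) :
    ∃ φ : intervalSeq k a b ⟶ W, ∀ i (h : InInterval a b i), φ.f i (intervalGen k h) = e i := by
  classical
  let g : ∀ i, (intervalSeq k a b).X i ⟶ W.X i := fun i =>
    if h : InInterval a b i then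
      eqToHom (intervalSeq_X_of_mem h) ≫ ModuleCat.ofHom (LinearMap.toSpanSingleton k _ (e i))
    else 0
  have hg : ∀ i (h : InInterval a b i), g i (intervalGen k h) = e i := by
    intro i h
    have e1 : g i = eqToHom (intervalSeq_X_of_mem h) ≫
        ModuleCat.ofHom (LinearMap.toSpanSingleton k _ (e i)) := dif_pos h
    rw [e1]
    change (eqToHom (intervalSeq_X_of_mem h).symm ≫ eqToHom (intervalSeq_X_of_mem h) ≫
      ModuleCat.ofHom (LinearMap.toSpanSingleton k _ (e i))) (1 : k) = e i
    rw [eqToHom_trans_assoc, eqToHom_refl, Category.id_comp]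
    exact one_smul k (e i)
  refine ⟨{ f := g, comm := fun i => ModuleCat.hom_ext (LinearMap.ext fun x => ?_) }, hg⟩
  change W.δ i (g i x) = g (i + 1) ((intervalSeq k a b).δ i x)
  by_cases h : InInterval a b i
  · obtain ⟨r, rfl⟩ := eq_smul_intervalGen h x
    rw [map_smul, map_smul, map_smul, map_smul, hg]
    by_cases h' : InInterval a b (i + 1)
    · rw [intervalSeq_δ_gen h h', he i h h', Units.smul_def, Units.smul_def, map_zsmul, hg]
    · rw [he' i h h', eq_zero_of_not_mem h' ((intervalSeq k a b).δ i _), map_zero]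
  · rw [eq_zero_of_not_mem h x]
    simp only [map_zero]

theorem exists_inInterval (h : EndpointLE a b) : ∃ i, InInterval a b i := by
  induction a using WithBot.recBotCoe with
  | bot =>
    induction b using WithTop.recTopCoe with
    | top => exact ⟨0, bot_le, le_top⟩
    | coe b => exact ⟨b, bot_le, le_rfl⟩
  | coe a =>
    refine ⟨a, le_rfl, ?_⟩
    have h' : ((a : WithTop ℤ) : WithBot (WithTop ℤ)) ≤ (b : WithBot (WithTop ℤ)) := h
    exact WithBot.coe_le_coe.1 h'

theorem inInterval_of_le_of_le {i j l : ℤ} (hi : InInterval a b i) (hl : InInterval a b l)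
    (hij : i ≤ j) (hjl : j ≤ l) : InInterval a b j :=
  ⟨hi.1.trans (WithBot.coe_le_coe.2 hij), (WithTop.coe_le_coe.2 hjl).trans hl.2⟩

/-- The endomorphisms of `S_{a,b}` are the scalars. -/
theorem exists_scalar_of_end (φ : intervalSeq k a b ⟶ intervalSeq k a b) :
    ∃ r : k, ∀ i (h : InInterval a b i), φ.f i (intervalGen k h) = r • intervalGen k h := by
  choose c hc using fun i (h : InInterval a b i) =>
    eq_smul_intervalGen h (φ.f i (intervalGen k h))
  have step : ∀ i (h : InInterval a b i) (h' : InInterval a b (i + 1)), c i h = c (i + 1) h' := by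
    intro i h h'
    have := SeqObj.comm_apply φ i (intervalGen k h)
    rw [hc, map_smul, intervalSeq_δ_gen h h', Units.smul_def, map_zsmul, hc, smul_comm,
      ← Units.smul_def, ← Units.smul_def] at this
    exact smul_intervalGen_injective h' (smul_left_cancel _ this)
  have steps : ∀ (m : ℕ) i (h : InInterval a b i) (h' : InInterval a b (i + m)),
      c i h = c (i + m) h' := by
    intro m
    induction m with
    | zero => intro i h h'; congr 1; simp
    | succ m ih =>
      intro i h h'
      have h'' : InInterval a b (i + m) :=
        inInterval_of_le_of_le h h' (by omega) (by push_cast; omega)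
      have e : i + (m + 1 : ℕ) = i + m + 1 := by push_cast; ring
      have h3 : InInterval a b (i + m + 1) := e ▸ h'
      rw [ih i h h'', step (i + m) h'' h3]
      congr 1
      exact e.symm
  have const : ∀ i j (h : InInterval a b i) (h' : InInterval a b j), i ≤ j → c i h = c j h' := by
    intro i j h h' hij
    obtain ⟨m, rfl⟩ : ∃ m : ℕ, j = i + m := ⟨(j - i).toNat, by omega⟩
    exact steps m i h h'
  by_cases hne : ∃ i, InInterval a b i
  · obtain ⟨i, hi⟩ := hne
    refine ⟨c i hi, fun j h => ?_⟩
    rw [hc]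
    rcases le_total i j with hij | hij
    · rw [const i j hi h hij]
    · rw [const j i h hi hij]
  · exact ⟨0, fun i h => (hne ⟨i, h⟩).elim⟩

/-- A decomposition of `S_{a,b}` gives an idempotent endomorphism, that is, the scalar `0` or `1`;
accordingly one of the two summands vanishes. -/
theorem isIndecomposableObj_intervalSeq (hab : EndpointLE a b) :
    IsIndecomposableObj (intervalSeq k a b) := by
  obtain ⟨i₀, h₀⟩ := exists_inInterval hab
  refine ⟨fun hz => ?_, fun Y Z p q ⟨hc⟩ => ?_⟩
  · have h1 := congrArg (fun f : intervalSeq k a b ⟶ intervalSeq k a b => f.f i₀ (intervalGen k h₀))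
      ((IsZero.iff_id_eq_zero _).1 hz)
    have h2 : (1 : k) • intervalGen k h₀ = (0 : k) • intervalGen k h₀ := by
      rw [one_smul, zero_smul]
      exact h1
    exact one_ne_zero (smul_intervalGen_injective h₀ h2)
  · obtain ⟨r, hpr, hqr⟩ : ∃ r : intervalSeq k a b ⟶ Y, p ≫ r = 𝟙 Y ∧ q ≫ r = 0 :=
      ⟨_, (BinaryCofan.IsColimit.desc' hc (𝟙 Y) 0).2⟩
    obtain ⟨r', -, hqr'⟩ : ∃ r' : intervalSeq k a b ⟶ Z, p ≫ r' = 0 ∧ q ≫ r' = 𝟙 Z :=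
      ⟨_, (BinaryCofan.IsColimit.desc' hc 0 (𝟙 Z)).2⟩
    obtain ⟨c, hcφ⟩ := exists_scalar_of_end (r ≫ p)
    have hidem : (r ≫ p) ≫ (r ≫ p) = r ≫ p := by
      rw [Category.assoc, ← Category.assoc p, hpr, Category.id_comp]
    have hcc : c * c = c := by
      have h1 := congrArg (fun f : intervalSeq k a b ⟶ intervalSeq k a b =>
        f.f i₀ (intervalGen k h₀)) hidem
      have h2 : (r ≫ p).f i₀ ((r ≫ p).f i₀ (intervalGen k h₀)) = (r ≫ p).f i₀ (intervalGen k h₀) :=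
        h1
      rw [hcφ, map_smul, hcφ, smul_smul] at h2
      exact smul_intervalGen_injective h₀ h2
    rcases (IsIdempotentElem.iff_eq_zero_or_one (p := c)).1 hcc with rfl | rfl
    · left
      have hrp : r ≫ p = 0 := intervalSeq_hom_ext fun i h => by
        rw [hcφ, zero_smul]
        rfl
      rw [IsZero.iff_id_eq_zero, ← Category.id_comp (𝟙 Y), ← hpr, Category.assoc,
        ← Category.assoc r, hrp, zero_comp, comp_zero]
    · right
      have hrp : r ≫ p = 𝟙 _ := intervalSeq_hom_ext fun i h => by
        rw [hcφ, one_smul]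
        rfl
      rw [IsZero.iff_id_eq_zero, ← hqr', ← Category.comp_id q, ← hrp, ← Category.assoc q, hqr,
        zero_comp, zero_comp]

theorem intervalDecomposable_le_completelyDecomposable :
    intervalDecomposable k ≤ completelyDecomposable (SeqVect k) := by
  rintro V ⟨J, a, b, inc, hab, hc⟩
  exact ⟨J, fun j => intervalSeq k (a j) (b j), inc,
    fun j => isIndecomposableObj_intervalSeq (hab j), hc⟩

/-- Coproducts in the category of sequences are computed degreewise: a family of morphisms from
interval objects exhibits `V` as their coproduct if the images of the generators form a basis in
each degree. -/
theorem nonempty_isColimit_of_basis {V : SeqVect k} {J : Type u} {a : J → WithBot ℤ}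
    {b : J → WithTop ℤ} (inc : ∀ j, intervalSeq k (a j) (b j) ⟶ V)
    (li : ∀ i, LinearIndependent k fun p : {p : J // InInterval (a p) (b p) i} =>
      (inc p.1).f i (intervalGen k p.2))
    (sp : ∀ i, ⊤ ≤ Submodule.span k (Set.range fun p : {p : J // InInterval (a p) (b p) i} =>
      (inc p.1).f i (intervalGen k p.2))) :
    Nonempty (IsColimit (Cofan.mk V inc)) := by
  let B := fun i => Module.Basis.mk (li i) (sp i)
  have B_apply : ∀ i p, B i p = (inc p.1).f i (intervalGen k p.2) := fun i p =>
    Module.Basis.mk_apply _ _ p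
  let F : ∀ (W : SeqVect k) (_ : ∀ j, intervalSeq k (a j) (b j) ⟶ W) (i : ℤ), V.X i →ₗ[k] W.X i :=
    fun W g i => (B i).constr k fun p => (g p.1).f i (intervalGen k p.2)
  have hF : ∀ (W : SeqVect k) (g : ∀ j, intervalSeq k (a j) (b j) ⟶ W) j i x,
      F W g i ((inc j).f i x) = (g j).f i x := by
    intro W g j i x
    by_cases h : InInterval (a j) (b j) i
    · obtain ⟨r, rfl⟩ := eq_smul_intervalGen h x
      rw [map_smul, map_smul, map_smul]
      congr 1
      rw [← B_apply i ⟨j, h⟩]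
      exact (B i).constr_basis k _ _
    · rw [eq_zero_of_not_mem h x, map_zero, map_zero, map_zero]
  let desc : ∀ (W : SeqVect k) (_ : ∀ j, intervalSeq k (a j) (b j) ⟶ W), V ⟶ W := fun W g =>
    { f := fun i => ModuleCat.ofHom (F W g i)
      comm := fun i => by
        refine ModuleCat.hom_ext ((B i).ext fun p => ?_)
        rw [B_apply]
        change W.δ i (F W g i ((inc p.1).f i (intervalGen k p.2))) =
          F W g (i + 1) (V.δ i ((inc p.1).f i (intervalGen k p.2)))
        rw [hF, SeqObj.comm_apply, SeqObj.comm_apply, hF] }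
  refine ⟨Cofan.IsColimit.mk _ (fun s => desc s.pt s.inj) (fun s j => ?_) (fun s m hm => ?_)⟩
  · exact SeqObj.hom_ext fun i x => hF s.pt s.inj j i x
  · refine SeqObj.Hom.ext (funext fun i => ModuleCat.hom_ext ((B i).ext fun p => ?_))
    rw [B_apply]
    refine Eq.trans ?_ (hF s.pt s.inj p.1 i (intervalGen k p.2)).symm
    exact congrArg (fun f : intervalSeq k (a p.1) (b p.1) ⟶ s.pt => f.f i (intervalGen k p.2))
      (hm p.1)

end IntervalSeq

/-! ### Decomposition into interval objects -/

section Decomposition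

variable {k : Type u} [Field k]

/-- Locally nilpotent sequences satisfying the chain condition on images are coproducts of interval
objects. -/
theorem intervalDecomposable_of_imagesStabilize {V : SeqVect k}
    (hL : ImagesStabilize fun i => (V.δ i).hom) (hN : LocallyNilpotent fun i => (V.δ i).hom) :
    intervalDecomposable k V := by
  obtain ⟨J, a, b, e, hab, he, he', hB⟩ := hL.exists_chain_basis hN
  -- the sign `σ i` turns a chain into one whose structure maps carry the sign `(-1) ^ i`
  let σ : ℤ → ℤˣ := fun i => (i * (i - 1) / 2).negOnePow
  have hσ : ∀ i, σ i = i.negOnePow * σ (i + 1) := by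
    intro i
    have e1 : (i + 1) * (i + 1 - 1) / 2 = i * (i - 1) / 2 + i := by
      rw [show (i + 1) * (i + 1 - 1) = i * (i - 1) + i * 2 by ring,
        Int.add_mul_ediv_right _ _ (by norm_num)]
    change (i * (i - 1) / 2).negOnePow = i.negOnePow * ((i + 1) * (i + 1 - 1) / 2).negOnePow
    rw [e1, Int.negOnePow_add, mul_left_comm, Int.units_mul_self, mul_one]
  have mem : ∀ p (i : ℤ), InInterval (a p) (b p : WithTop ℤ) i ↔
      a p ≤ (i : WithBot ℤ) ∧ i ≤ b p := fun p i => and_congr_right' WithTop.coe_le_coe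
  have hom : ∀ p, ∃ φ : intervalSeq k (a p) (b p : WithTop ℤ) ⟶ V,
      ∀ i (h : InInterval (a p) (b p : WithTop ℤ) i),
        φ.f i (intervalGen k h) = σ i • e p i := by
    intro p
    refine exists_intervalSeq_hom (fun i => σ i • e p i) (fun i h h' => ?_) fun i h h' => ?_
    · rw [mem] at h h'
      have := he p i h.1 (by omega)
      change V.δ i (e p i) = _ at this
      rw [Units.smul_def, map_zsmul, this, ← Units.smul_def, smul_smul, ← hσ]
    · rw [mem] at h h'
      obtain rfl : i = b p := by
        by_contra hne
        exact h' ⟨h.1.trans (WithBot.coe_le_coe.2 (by omega)), by omega⟩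
      have := he' p
      change V.δ _ (e p _) = _ at this
      rw [Units.smul_def, map_zsmul, this, smul_zero]
  choose inc hinc using hom
  refine ⟨J, a, fun p => (b p : WithTop ℤ), inc, fun p => ?_, nonempty_isColimit_of_basis inc ?_ ?_⟩
  · have hp := hab p
    change WithBot.map _ (a p) ≤ _
    generalize a p = c at hp ⊢
    induction c using WithBot.recBotCoe with
    | bot => exact bot_le
    | coe c => exact WithBot.coe_le_coe.2 (WithTop.coe_le_coe.2 (WithBot.coe_le_coe.1 hp))
  · intro i
    have hli := ((hB i).1.comp (fun p : {p // InInterval (a p) (b p : WithTop ℤ) i} =>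
      (⟨p.1, (mem p.1 i).1 p.2⟩ : {p // a p ≤ (i : WithBot ℤ) ∧ i ≤ b p})) fun p q h =>
        Subtype.ext (congrArg Subtype.val h :)).units_smul
        fun _ => Units.map (Int.castRingHom k).toMonoidHom (σ i)
    convert hli using 2 with p
    rw [hinc, Units.smul_def, ← Int.cast_smul_eq_zsmul k]
    rfl
  · intro i
    refine (hB i).2.trans (Submodule.span_le.2 ?_)
    rintro _ ⟨p, rfl⟩
    have h : InInterval (a p) (b p : WithTop ℤ) i := (mem p.1 i).2 p.2
    have hp : e p i = σ i • (inc p).f i (intervalGen k h) := by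
      rw [hinc, smul_smul, Int.units_mul_self, one_smul]
    change e p i ∈ _
    rw [hp, Units.smul_def]
    exact zsmul_mem (Submodule.subset_span (Set.mem_range_self
      (⟨p.1, h⟩ : {p // InInterval (a p) (b p : WithTop ℤ) i}))) _

end Decomposition

/-! ### Conditions in the derived category -/

section Derived

variable {k : Type u} [Field k] [HasDerivedCategory.{w} (ModDual k)]

theorem imagesStabilize_of_derivedPlus {V : SeqVect k}
    (h : derivedPlus k (DerivedCategory.Q.obj (minimalComplex V))) :
    ImagesStabilize fun i => (V.δ i).hom := by
  obtain ⟨n, hn⟩ := h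
  have hn' : (DerivedCategory.Q.obj (minimalComplex V)).IsGE n := hn
  rw [DerivedCategory.isGE_Q_obj_iff, CochainComplex.isGE_iff] at hn'
  exact imagesStabilize_of_surjective (n := n - 1) fun i hi =>
    surjective_of_exactAt (hn' (i + 1) (by omega))

theorem imagesStabilize_of_derivedFG {V : SeqVect k}
    (h : derivedFG k (DerivedCategory.Q.obj (minimalComplex V))) :
    ImagesStabilize fun i => (V.δ i).hom := by
  refine imagesStabilize_of_finite_ker fun i => ?_
  obtain ⟨i, rfl⟩ : ∃ i', i = i' + 1 := ⟨i - 1, by omega⟩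
  have : Module.Finite (DualNumber k) ((DerivedCategory.Q ⋙
      DerivedCategory.homologyFunctor (ModDual k) (i + 1)).obj (minimalComplex V)) := h (i + 1)
  exact finite_ker_of_finite_homology (Module.Finite.equiv (R := DualNumber k)
    ((DerivedCategory.homologyFunctorFactors (ModDual k) (i + 1)).app
      (minimalComplex V)).toLinearEquiv)

theorem derivedStrictlyBounded_le_derivedPlus : derivedStrictlyBounded k ≤ derivedPlus k := by
  rintro X ⟨P, -, ⟨m, n, hP⟩, ⟨e⟩⟩
  refine ⟨m, ⟨P, e, ?_⟩⟩
  rw [CochainComplex.isStrictlyGE_iff]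
  exact fun i hi => hP i (Or.inl hi)

theorem seqP_le_intervalDecomposable {P : ObjectProperty (DerivedCategory (ModDual k))}
    (hP : P ≤ derivedPlus k ⊔ derivedFG k) : seqP P ≤ intervalDecomposable k := by
  rintro V ⟨hV, h⟩
  exact intervalDecomposable_of_imagesStabilize
    ((hP _ h).elim imagesStabilize_of_derivedPlus imagesStabilize_of_derivedFG)
    (locallyNilpotent_of_isKProjective hV)

end Derived

theorem mainTheorem3 (k : Type u) [Field k] [HasDerivedCategory.{w} (ModDual k)] :
    (seqP (derivedStrictlyBounded k) ⊓ intervalDecomposable k = seqP (derivedStrictlyBounded k) ∧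
      seqP (derivedBounded k) ⊓ intervalDecomposable k = seqP (derivedBounded k) ∧
      seqP (derivedPlus k) ⊓ intervalDecomposable k = seqP (derivedPlus k) ∧
      seqP (derivedBounded k ⊓ derivedFG k) ⊓ intervalDecomposable k =
        seqP (derivedBounded k ⊓ derivedFG k) ∧
      seqP (derivedMinus k ⊓ derivedFG k) ⊓ intervalDecomposable k =
        seqP (derivedMinus k ⊓ derivedFG k)) ∧
    (seqP (derivedStrictlyBounded k) ≤ completelyDecomposable (SeqVect k) ∧
      seqP (derivedBounded k) ≤ completelyDecomposable (SeqVect k) ∧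
      seqP (derivedPlus k) ≤ completelyDecomposable (SeqVect k) ∧
      seqP (derivedBounded k ⊓ derivedFG k) ≤ completelyDecomposable (SeqVect k) ∧
      seqP (derivedMinus k ⊓ derivedFG k) ≤ completelyDecomposable (SeqVect k)) := by
  have sb := seqP_le_intervalDecomposable (k := k)
    (derivedStrictlyBounded_le_derivedPlus.trans le_sup_left)
  have bd := seqP_le_intervalDecomposable (k := k) (P := derivedBounded k)
    (le_trans inf_le_left le_sup_left)
  have pl := seqP_le_intervalDecomposable (k := k) (P := derivedPlus k) le_sup_left
  have bf := seqP_le_intervalDecomposable (k := k) (P := derivedBounded k ⊓ derivedFG k)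
    (inf_le_right.trans le_sup_right)
  have mf := seqP_le_intervalDecomposable (k := k) (P := derivedMinus k ⊓ derivedFG k)
    (inf_le_right.trans le_sup_right)
  have cd := intervalDecomposable_le_completelyDecomposable (k := k)
  exact ⟨⟨inf_eq_left.2 sb, inf_eq_left.2 bd, inf_eq_left.2 pl, inf_eq_left.2 bf,
    inf_eq_left.2 mf⟩, sb.trans cd, bd.trans cd, pl.trans cd, bf.trans cd, mf.trans cd⟩
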